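/- Let $W$ be a finite Coxeter group with set $S$ of fundamental reflections, Coxeter matrix $(m_{r,s})_{r,s\in S}$ and length function $\ell$. The right weak order $<_R$ on $W$ is the transitive closure of the relation: $u<_R us$ if $s\in S$ and $\ell(us)=\ell(u)+1$. Let $\mathrm{Sym}(n)$ be the symmetric group on $\{1,\dots,n\}$ with $(\sigma\tau)(i)=\sigma(\tau(i))$, regarded as a Coxeter group with fundamental reflections the transpositions $(i,i+1)$; its Bruhat order $<_B$ is the transitive closure of the relation: $u<_B ut$ if $t$ is a transposition and $\ell(ut)=\ell(u)+1$. An injective homomorphism $\varphi:W\to\mathrm{Sym}(n)$ is called an E-embedding if $u<_R v$ implies $\varphi(u)<_B\varphi(v)$ for all $u,v\in W$. Let $\varphi:W\to\mathrm{Sym}(n)$ be an E-embedding and let $\alpha\in[\pi/4,\pi/2)$. For $k=1,\dots,n$ put $\theta_k=\frac{(k-1)(\pi-2\alpha)}{n-1}+\alpha$ (and $\theta_1=\alpha$ if $n=1$) and $\beta^k=(-\cos\theta_k,\sin\theta_k)\in\mathbb{R}^2$. The border $\mathrm{B}(\sigma)\subseteq\mathbb{R}^2$ of $\sigma\in\mathrm{Sym}(n)$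 is the union, for $i=1,\dots,n$, of the line segments with end points $\sum_{j=1}^{i-1}\beta^{\sigma(j)}$ and $\sum_{j=1}^{i}\beta^{\sigma(j)}$. The tiling of a reduced word $s_{1}s_{2}\cdots s_{k}$ (with $s_1,\dots,s_k\in S$) is the set $\mathrm{T}_\varphi(s_{1}\cdots s_{k})=\bigcup_{j=0}^{k}\mathrm{B}(\varphi(s_{1}\cdots s_{j}))$, and $\mathcal{T}_\varphi(w)$ denotes the set of the tilings of all reduced words of $w\in W$. Let $J_\varphi$ be the set of those pairs $\{r,s\}$ with $r,s\in S$ such that, in every reduced word (of any element of $W$) that contains one of the two alternating words $rsr\cdots$, $srs\cdots$ with $m_{r,s}$ letters as a consecutive subword, replacing this subword by the other one (a braid move for the pair $\{r,s\}$) does not change the tiling. Let $\mathcal{R}_{J_\varphi}(w)$ be the set of equivalence classes of the reduced words of $w$ under the equivalence relation generated by the braid moves for the pairs in $J_\varphi$. Then for every $w\in W$ there is a bijection between $\mathcal{T}_\varphi(w)$ and $\mathcal{R}_{J_\varphi}(w)$; more precisely, there is one which sends the tiling of each reduced word of $w$ to the class of that word. -/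

import Mathlib

/-! ### The symmetric group: length and Bruhat order -/

/-- The fundamental reflections `(i, i+1)` of the symmetric group on `Fin n`. -/
def IsAdjacentSwap {n : ℕ} (σ : Equiv.Perm (Fin n)) : Prop :=
  ∃ i j : Fin n, (i : ℕ) + 1 = (j : ℕ) ∧ σ = Equiv.swap i j

/-- The Coxeter length on the symmetric group: the least number of factors in an expression
as a product of adjacent transpositions. -/
noncomputable def symLength {n : ℕ} (σ : Equiv.Perm (Fin n)) : ℕ :=
  sInf {k : ℕ | ∃ l : List (Equiv.Perm (Fin n)),
    l.length = k ∧ (∀ τ ∈ l, IsAdjacentSwap τ) ∧ l.prod = σ}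

/-- One step of the Bruhat order: `v = u * t` with `t` a reflection (a transposition)
and the length of `v` one more than the length of `u`. -/
def BruhatStep {n : ℕ} (u v : Equiv.Perm (Fin n)) : Prop :=
  ∃ t : Equiv.Perm (Fin n), t.IsSwap ∧ v = u * t ∧ symLength v = symLength u + 1

/-- The strict Bruhat order on the symmetric group. -/
def BruhatLT {n : ℕ} (u v : Equiv.Perm (Fin n)) : Prop :=
  Relation.TransGen BruhatStep u v

/-! ### The right weak order and E-embeddings -/

/-- One step of the right weak order: `v = u * s` with `s` a fundamental reflection
and the length of `v` one more than the length of `u`. -/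
def WeakStep {B W : Type*} [Group W] {M : CoxeterMatrix B} (cs : CoxeterSystem M W)
    (u v : W) : Prop :=
  ∃ i : B, v = u * cs.simple i ∧ cs.length v = cs.length u + 1

/-- The strict right weak order on a Coxeter group. -/
def WeakLT {B W : Type*} [Group W] {M : CoxeterMatrix B} (cs : CoxeterSystem M W)
    (u v : W) : Prop :=
  Relation.TransGen (WeakStep cs) u v

/-- An E-embedding: an injective homomorphism to a symmetric group which carries the strict
right weak order into the strict Bruhat order. -/
structure IsEEmbedding {B W : Type*} [Group W] {M : CoxeterMatrix B} (cs : CoxeterSystem M W)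
    {n : ℕ} (φ : W →* Equiv.Perm (Fin n)) : Prop where
  injective : Function.Injective φ
  weak_bruhat : ∀ u v : W, WeakLT cs u v → BruhatLT (φ u) (φ v)

/-! ### Borders and tilings -/

/-- The underlying unit vectors. The index `k : Fin n` runs from `0` to `n - 1`
(so it is one less than the customary index in `{1, …, n}`). -/
noncomputable def underlyingVector (n : ℕ) (α : ℝ) (k : Fin n) : ℝ × ℝ :=
  (-Real.cos (((k : ℕ) : ℝ) * (Real.pi - 2 * α) / ((n : ℝ) - 1) + α),
    Real.sin (((k : ℕ) : ℝ) * (Real.pi - 2 * α) / ((n : ℝ) - 1) + α))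

/-- The `j`-th vertex of the border of `σ`: the sum of the first `j` vectors of the sequence
whose term in position `i` is the underlying vector with index `σ i`.

Here permutations compose as functions, `(σ * τ) i = σ (τ i)`, so that right multiplication by
a transposition exchanges two positions of the sequence. If permutations `w` are instead written
on the right of their arguments and composed from left to right, then `σ i` is `(i)w⁻¹`, and
`w ↦ σ` is an isomorphism of groups which preserves the fundamental reflections. -/
noncomputable def borderVertex {n : ℕ} (α : ℝ) (σ : Equiv.Perm (Fin n)) (j : ℕ) : ℝ × ℝ :=
  ∑ i ∈ Finset.univ.filter (fun i : Fin n => (i : ℕ) < j), underlyingVector n α (σ i)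

/-- The border of `σ`: the union of its `n` unit edges, as a set of points of the plane. -/
noncomputable def border {n : ℕ} (α : ℝ) (σ : Equiv.Perm (Fin n)) : Set (ℝ × ℝ) :=
  ⋃ i : Fin n, segment ℝ (borderVertex α σ (i : ℕ)) (borderVertex α σ ((i : ℕ) + 1))

/-- The tiling of a word: the union of the borders of (the images of) all its prefixes,
from the empty word to the whole word. -/
noncomputable def tiling {B W : Type*} [Group W] {M : CoxeterMatrix B} (cs : CoxeterSystem M W)
    {n : ℕ} (φ : W →* Equiv.Perm (Fin n)) (α : ℝ) (ω : List B) : Set (ℝ × ℝ) :=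
  ⋃ j ∈ Finset.range (ω.length + 1), border α (φ (cs.wordProd (ω.take j)))

/-- The reduced words which evaluate to `w`. -/
def ReducedWord {B W : Type*} [Group W] {M : CoxeterMatrix B} (cs : CoxeterSystem M W)
    (w : W) : Type _ :=
  {ω : List B // cs.IsReduced ω ∧ cs.wordProd ω = w}

/-- The set of the tilings of all reduced words of `w`. -/
def tilingSet {B W : Type*} [Group W] {M : CoxeterMatrix B} (cs : CoxeterSystem M W)
    {n : ℕ} (φ : W →* Equiv.Perm (Fin n)) (α : ℝ) (w : W) : Set (Set (ℝ × ℝ)) :=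
  Set.range fun ω : ReducedWord cs w => tiling cs φ α ω.1

/-! ### Braid moves -/

/-- The set of the pairs `{r, s}` of generators such that, in every reduced word, replacing
a consecutive subword that alternates between `r` and `s` and has length `M r s` by the other
such word does not change the tiling. (Both orders of the pair are tested: `M.braidWord r s`
ends in `s`, and `M.braidWord s r` ends in `r`. For `r = s` the move is trivial.) -/
def preservingPairs {B W : Type*} [Group W] {M : CoxeterMatrix B} (cs : CoxeterSystem M W)
    {n : ℕ} (φ : W →* Equiv.Perm (Fin n)) (α : ℝ) : Set (Sym2 B) :=
  {p | ∀ r s : B, p = s(r, s) → ∀ x y : List B,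
    cs.IsReduced (x ++ CoxeterSystem.braidWord M r s ++ y) →
      tiling cs φ α (x ++ CoxeterSystem.braidWord M r s ++ y) =
        tiling cs φ α (x ++ CoxeterSystem.braidWord M s r ++ y)}

/-- `ω'` arises from `ω` by one braid move for a pair in `J`. -/
def BraidMove {B : Type*} (M : CoxeterMatrix B) (J : Set (Sym2 B)) (ω ω' : List B) : Prop :=
  ∃ (r s : B) (x y : List B), s(r, s) ∈ J ∧
    ω = x ++ CoxeterSystem.braidWord M r s ++ y ∧ ω' = x ++ CoxeterSystem.braidWord M s r ++ y

/-- The equivalence relation on the reduced words of `w` generated by the braid moves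
for the pairs in `J`. -/
def braidSetoid {B W : Type*} [Group W] {M : CoxeterMatrix B} (cs : CoxeterSystem M W)
    (J : Set (Sym2 B)) (w : W) : Setoid (ReducedWord cs w) :=
  Relation.EqvGen.setoid fun ω ω' => BraidMove M J ω.1 ω'.1

/-- The equivalence classes of the reduced words of `w` under the braid moves
for the pairs in `J`. -/
def BraidClasses {B W : Type*} [Group W] {M : CoxeterMatrix B} (cs : CoxeterSystem M W)
    (J : Set (Sym2 B)) (w : W) : Type _ :=
  Quotient (braidSetoid cs J w)

/-! All underlying vectors have angles in [π/4, 3π/4], increasing with the index. Hence borders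
climb inside the closed vertical cone, while `β^b - β^a` with `a < b` lies in the open horizontal
cone (`Rightward`). A Bruhat step adds such differences to some vertices and fixes the others, so
along a reduced word the borders sweep to the right. Two points of one border never differ by a
rightward vector (`not_rightward_sub`). Which vertices a letter `s` can move depends on `φ s` alone:
vertex `k` stays if `φ s` preserves the first `k` positions, and otherwise moves strictly right at
every ascent. Suppose that `ω` and `s :: ω'` have the same tiling from `x`. Let `t` be the first
letter of `ω` that moves an edge moved by `s`. On the first common edge, neither of the borders made
by `s` and by `t` can be strictly left of the other, which forces `φ s` and `φ t` to act alike on an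
initial segment that both move (`exists_inv_mul_preservesInitial`). If `t ≠ s`, then `ts` has length
2, and its border has to pass the border of 1 strictly at a vertex where the two agree; so `t = s`
(`exists_eq_append_cons`). The letters before this `s` are edge-disjoint from it. They commute with
it, and swapping them past it keeps the tiling, so these pairs lie in `J`. With `s` moved to the
front, cutting the common tiling along the border of `xs` leaves equal tilings of the two tails, and
induction applies. Conversely, moves in `J` preserve tilings by definition. -/

/-! ### The reflection representation of a Coxeter group -/

section ReflectionRepresentation

open Polynomial.Chebyshev in
/-- The product of two reflections at angle `π / m` has order dividing `m`. -/
theorem Module.reflection_mul_reflection_pow_eq_one {V : Type*} [AddCommGroup V] [Module ℝ V]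
    {x y : V} {f g : Module.Dual ℝ V} (hf : f x = 2) (hg : g y = 2) {m : ℕ} (hm : 2 ≤ m)
    (hfy : f y = -2 * Real.cos (Real.pi / m)) (hgx : g x = -2 * Real.cos (Real.pi / m)) :
    (Module.reflection hf * Module.reflection hg) ^ m = 1 := by
  ext z
  rw [Module.reflection_mul_reflection_pow_apply hf hg m z _ rfl]
  -- For `m = 2` the angle `θ` below is π and its sine cannot be cancelled.
  obtain rfl | hm3 := hm.eq_or_lt
  · simp [hfy, hgx, S_one]
    module
  · have hm0 : (0 : ℝ) < m := by positivity
    have hm2 : (2 : ℝ) < m := by exact_mod_cast hm3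
    set θ : ℝ := 2 * Real.pi / m with hθ
    have hmθ : (m : ℝ) * θ = 2 * Real.pi := by rw [hθ]; field_simp
    have ht : f y * g x - 2 = 2 * Real.cos θ := by
      rw [hfy, hgx, hθ, show 2 * Real.pi / m = 2 * (Real.pi / m) by ring, Real.cos_two_mul]
      ring
    have hsin : Real.sin θ ≠ 0 := by
      refine (Real.sin_pos_of_pos_of_lt_pi (by positivity) ?_).ne'
      rw [hθ, div_lt_iff₀ hm0]
      nlinarith [Real.pi_pos]
    rw [ht]
    -- `S k` at `2 cos θ` is `sin ((k + 1) θ) / sin θ`, and sines of angles with sum 2π cancel.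
    have key : ∀ k l : ℤ, ((k + 1 : ℝ) + (l + 1)) * θ = 2 * Real.pi →
        (S ℝ k).eval (2 * Real.cos θ) + (S ℝ l).eval (2 * Real.cos θ) = 0 := by
      intro k l hkl
      have hk := S_two_mul_real_cos θ k
      have hl := S_two_mul_real_cos θ l
      have : Real.sin ((k + 1) * θ) = -Real.sin ((l + 1) * θ) := by
        rw [show ((k : ℝ) + 1) * θ = 2 * Real.pi - (l + 1) * θ by linarith,
          Real.sin_two_pi_sub]
      have h0 : ((S ℝ k).eval (2 * Real.cos θ) + (S ℝ l).eval (2 * Real.cos θ)) *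
          Real.sin θ = 0 := by
        rw [add_mul, hk, hl, this]; ring
      exact (mul_eq_zero.1 h0).resolve_right hsin
    obtain ⟨k, rfl | rfl⟩ := Nat.even_or_odd' m
    · have h1 : (((2 * k : ℕ) : ℤ) - 2) / 2 = k - 1 := by omega
      have h2 : (((2 * k : ℕ) : ℤ) - 1) / 2 = k - 1 := by omega
      have h3 : (S ℝ (k - 1)).eval (2 * Real.cos θ) = 0 := by
        have := key (k - 1) (k - 1) (by push_cast at hmθ ⊢; linarith)
        linarith
      rw [h1, h2, h3]
      simp
    · have h1 : (((2 * k + 1 : ℕ) : ℤ) - 1) / 2 = k := by omega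
      have h2 : (((2 * k + 1 : ℕ) : ℤ) - 3) / 2 = k - 1 := by omega
      have h3 : (((2 * k + 1 : ℕ) : ℤ)) / 2 = k := by omega
      have h4 : (((2 * k + 1 : ℕ) : ℤ) - 2) / 2 = k - 1 := by omega
      have h5 := key k (k - 1) (by push_cast at hmθ ⊢; linarith)
      rw [h1, h2, h3, h4, h5]
      simp

variable {B : Type*}

/-- Twice the standard symmetric bilinear form, paired with the `i`-th simple root. -/
noncomputable def CoxeterMatrix.simpleCoroot (M : CoxeterMatrix B) (i : B) :
    Module.Dual ℝ (B →₀ ℝ) :=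
  Finsupp.linearCombination ℝ fun j => -2 * Real.cos (Real.pi / M i j)

theorem CoxeterMatrix.simpleCoroot_single (M : CoxeterMatrix B) (i j : B) :
    M.simpleCoroot i (Finsupp.single j 1) = -2 * Real.cos (Real.pi / M i j) := by
  simp [CoxeterMatrix.simpleCoroot]

theorem CoxeterMatrix.simpleCoroot_single_self (M : CoxeterMatrix B) (i : B) :
    M.simpleCoroot i (Finsupp.single i 1) = 2 := by
  simp [CoxeterMatrix.simpleCoroot_single]

/-- The reflection in the `i`-th simple root. -/
noncomputable def CoxeterMatrix.simpleReflection (M : CoxeterMatrix B) (i : B) :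
    (B →₀ ℝ) ≃ₗ[ℝ] (B →₀ ℝ) :=
  Module.reflection (M.simpleCoroot_single_self i)

theorem CoxeterMatrix.simpleReflection_apply (M : CoxeterMatrix B) (i : B) (v : B →₀ ℝ) :
    M.simpleReflection i v = v - M.simpleCoroot i v • Finsupp.single i 1 :=
  Module.reflection_apply _ _

theorem CoxeterMatrix.isLiftable_simpleReflection (M : CoxeterMatrix B) :
    M.IsLiftable M.simpleReflection := by
  intro i j
  by_cases hij : i = j
  · subst hij
    ext1 v
    simpa [CoxeterMatrix.simpleReflection] using
      Module.involutive_reflection (M.simpleCoroot_single_self i) _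
  · have h1 := M.off_diagonal i j hij
    rcases Nat.lt_or_ge (M i j) 2 with h | h
    -- An off-diagonal entry below 2 is 0, which stands for infinite order and imposes no relation.
    · have : M i j = 0 := by omega
      rw [this, pow_zero]
    · refine Module.reflection_mul_reflection_pow_eq_one _ _ h
        (M.simpleCoroot_single i j) ?_
      rw [M.simpleCoroot_single j i, M.symmetric j i]

variable {W : Type*} [Group W] {M : CoxeterMatrix B} (cs : CoxeterSystem M W)

/-- The reflection representation of a Coxeter group. -/
noncomputable def CoxeterSystem.reflectionRepresentation :
    W →* ((B →₀ ℝ) ≃ₗ[ℝ] (B →₀ ℝ)) :=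
  cs.lift ⟨M.simpleReflection, M.isLiftable_simpleReflection⟩

theorem CoxeterSystem.reflectionRepresentation_simple (i : B) :
    cs.reflectionRepresentation (cs.simple i) = M.simpleReflection i :=
  cs.lift_apply_simple M.isLiftable_simpleReflection i

theorem CoxeterSystem.simple_injective : Function.Injective cs.simple := by
  intro i j h
  by_contra hij
  have h1 : M.simpleReflection i (Finsupp.single i 1) =
      M.simpleReflection j (Finsupp.single i 1) := by
    rw [← cs.reflectionRepresentation_simple, ← cs.reflectionRepresentation_simple, h]
  have h2 := DFunLike.congr_fun h1 i
  rw [M.simpleReflection_apply, M.simpleReflection_apply, M.simpleCoroot_single_self] at h2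
  simp [Ne.symm hij] at h2

/-- Commuting only says that the order of the product divides 2. The matrix entry itself, on which
the length of braid words depends, is recovered from the reflection representation. -/
theorem CoxeterSystem.matrix_eq_two_of_commute {i j : B} (hij : i ≠ j)
    (h : Commute (cs.simple i) (cs.simple j)) : M i j = 2 := by
  have h1 := congrArg cs.reflectionRepresentation h.eq
  rw [map_mul, map_mul, cs.reflectionRepresentation_simple,
    cs.reflectionRepresentation_simple] at h1
  -- The two orders of composition give opposite coefficients at the `j`-th simple root, so the
  -- cosine vanishes.
  have h2 := DFunLike.congr_fun (LinearEquiv.congr_fun h1 (Finsupp.single i 1)) j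
  simp only [LinearEquiv.mul_apply, M.simpleReflection_apply, map_sub, map_smul,
    M.simpleCoroot_single_self, M.simpleCoroot_single] at h2
  simp [Ne.symm hij, M.symmetric j i] at h2
  have h3 : Real.cos (Real.pi / M i j) = 0 := by linarith
  have hne := M.off_diagonal i j hij
  rcases Nat.lt_or_ge (M i j) 3 with h4 | h4
  · interval_cases hM : M i j
    · simp at h3
    · omega
    · rfl
  · exfalso
    have h5 : (3 : ℝ) ≤ M i j := by exact_mod_cast h4
    refine (Real.cos_pos_of_mem_Ioo ⟨?_, ?_⟩).ne' h3
    · have : 0 < Real.pi / M i j := by positivity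
      linarith [Real.pi_pos]
    · rw [div_lt_div_iff₀ (by linarith) two_pos]
      nlinarith [Real.pi_pos]

end ReflectionRepresentation

/-! ### Length and inversions in the symmetric group -/

section SymmetricGroup

open Equiv

variable {n : ℕ}

/-- An inversion of a product of adjacent transpositions can be undone by deleting a factor. -/
theorem exists_shorter_word_of_inversion (l : List (Perm (Fin n)))
    (hl : ∀ τ ∈ l, IsAdjacentSwap τ) {i j : Fin n} (hij : i < j) (h : l.prod j < l.prod i) :
    ∃ l' : List (Perm (Fin n)), l'.length + 1 = l.length ∧ (∀ τ ∈ l', IsAdjacentSwap τ) ∧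
      l'.prod = l.prod * swap i j := by
  induction l with
  | nil => simp at h; exact absurd hij h.not_gt
  | cons s l ih =>
    rw [List.forall_mem_cons] at hl
    rcases lt_or_ge (l.prod j) (l.prod i) with h1 | h1
    · obtain ⟨l', h2, h3, h4⟩ := ih hl.2 h1
      refine ⟨s :: l', by simp [h2], List.forall_mem_cons.2 ⟨hl.1, h3⟩, ?_⟩
      rw [List.prod_cons, List.prod_cons, h4, mul_assoc]
    · refine ⟨l, by simp, hl.2, ?_⟩
      have h2 : l.prod i < l.prod j := lt_of_le_of_ne h1 (l.prod.injective.ne hij.ne)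
      obtain ⟨a, b, hab, rfl⟩ := hl.1
      rw [List.prod_cons, Perm.mul_apply, Perm.mul_apply] at h
      -- An adjacent swap reverses the order of no two values except its own pair.
      have h3 : l.prod i = a ∧ l.prod j = b := by
        generalize l.prod i = p at h h2
        generalize l.prod j = q at h h2
        simp only [swap_apply_def, Fin.lt_def, Fin.ext_iff] at h h2 ⊢
        split_ifs at h <;> simp_all <;> omega
      rw [List.prod_cons, mul_assoc, Equiv.mul_swap_eq_swap_mul, h3.1, h3.2, ← mul_assoc,
        swap_mul_self, one_mul]

theorem exists_adjacentSwap_word (σ : Perm (Fin n)) :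
    ∃ l : List (Perm (Fin n)), (∀ τ ∈ l, IsAdjacentSwap τ) ∧ l.prod = σ := by
  cases n with
  | zero => exact ⟨[], by simp, Subsingleton.elim _ _⟩
  | succ m =>
    have h : σ ∈ Submonoid.closure (Set.range fun i : Fin m ↦ swap i.castSucc i.succ) := by
      rw [Perm.mclosure_swap_castSucc_succ]; trivial
    obtain ⟨l, h1, h2⟩ := Submonoid.exists_list_of_mem_closure h
    refine ⟨l, fun τ hτ => ?_, h2⟩
    obtain ⟨i, rfl⟩ := h1 τ hτ
    exact ⟨i.castSucc, i.succ, by simp, rfl⟩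

theorem symLength_mul_swap_lt {σ : Perm (Fin n)} {i j : Fin n} (hij : i < j) (h : σ j < σ i) :
    symLength (σ * swap i j) < symLength σ := by
  obtain ⟨l₀, h₀, h₀'⟩ := exists_adjacentSwap_word σ
  obtain ⟨l, h1, h2, h3⟩ := Nat.sInf_mem (s := {k : ℕ | ∃ l : List (Perm (Fin n)),
    l.length = k ∧ (∀ τ ∈ l, IsAdjacentSwap τ) ∧ l.prod = σ}) ⟨_, l₀, rfl, h₀, h₀'⟩
  obtain ⟨l', h4, h5, h6⟩ := exists_shorter_word_of_inversion l h2 hij (by rwa [h3])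
  have h7 : symLength (σ * swap i j) ≤ l'.length := Nat.sInf_le ⟨l', rfl, h5, by rw [h6, h3]⟩
  have h8 : l.length = symLength σ := h1
  omega

/-- Swapping an inverted pair would shorten the permutation. The length condition thus becomes an
inequality of values, which gives the direction in which the border moves. -/
theorem BruhatStep.exists_swap {σ τ : Perm (Fin n)} (h : BruhatStep σ τ) :
    ∃ i j : Fin n, i < j ∧ σ i < σ j ∧ τ = σ * swap i j := by
  obtain ⟨_, ⟨i, j, hij, rfl⟩, rfl, hlen⟩ := h
  wlog hlt : i < j generalizing i j
  · simpa [swap_comm] using this j i hij.symm (by rwa [swap_comm])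
      (lt_of_le_of_ne (not_lt.1 hlt) hij.symm)
  refine ⟨i, j, hlt, lt_of_le_of_ne (not_lt.1 fun h => ?_) (σ.injective.ne hij), rfl⟩
  have := symLength_mul_swap_lt hlt h
  omega

/-! ### Permutations preserving an initial segment -/

/-- The permutation `g` preserves the set of the first `k` positions. -/
def PreservesInitial (g : Perm (Fin n)) (k : ℕ) : Prop :=
  ∀ i, (g i : ℕ) < k ↔ (i : ℕ) < k

theorem PreservesInitial.one (k : ℕ) : PreservesInitial (1 : Perm (Fin n)) k := fun _ => Iff.rfl

theorem PreservesInitial.mul {g h : Perm (Fin n)} {k : ℕ} (hg : PreservesInitial g k)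
    (hh : PreservesInitial h k) : PreservesInitial (g * h) k :=
  fun i => (hg (h i)).trans (hh i)

theorem PreservesInitial.inv {g : Perm (Fin n)} {k : ℕ} (hg : PreservesInitial g k) :
    PreservesInitial g⁻¹ k := fun i => by
  simpa using (hg (g⁻¹ i)).symm

/-- A permutation preserving the first `e` and the first `e + 1` positions fixes position `e`. -/
theorem PreservesInitial.apply_eq {g : Perm (Fin n)} {e : Fin n}
    (h : PreservesInitial g e) (h' : PreservesInitial g (e + 1)) : g e = e := by
  have h1 := h e
  have h2 := h' e
  ext
  omega

theorem PreservesInitial.succ {g : Perm (Fin n)} {e : Fin n}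
    (h : PreservesInitial g e) (h' : g e = e) : PreservesInitial g (e + 1) := by
  intro i
  by_cases hi : i = e
  · subst hi; rw [h']
  · have h1 := h i
    have h2 : g i ≠ e := fun h3 => hi (g.injective (h3.trans h'.symm))
    rw [Ne, Fin.ext_iff] at h2
    rw [Fin.ext_iff] at hi
    omega

/-- Edge `e` of a border (in position `e`) has an end point which right multiplication by `g`
may move. -/
def MovesEdge (g : Perm (Fin n)) (e : Fin n) : Prop :=
  ¬PreservesInitial g e ∨ ¬PreservesInitial g (e + 1)

theorem apply_eq_of_not_movesEdge {g : Perm (Fin n)} {e : Fin n} (h : ¬MovesEdge g e) :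
    g e = e := by
  rw [MovesEdge, not_or, not_not, not_not] at h
  exact h.1.apply_eq h.2

/-- An unmoved edge `g e` would be a fixed point of `g`; then `e` is fixed too, and `g` preserves
one more position. -/
theorem movesEdge_apply {g : Perm (Fin n)} {e : Fin n} (h : PreservesInitial g e)
    (h' : ¬PreservesInitial g (e + 1)) : MovesEdge g (g e) := by
  by_contra h1
  exact h' (h.succ (g.injective (apply_eq_of_not_movesEdge h1)))

theorem exists_movesEdge {g : Perm (Fin n)} (hg : g ≠ 1) : ∃ e, MovesEdge g e := by
  by_contra! h
  exact hg (Equiv.ext fun e => apply_eq_of_not_movesEdge (h e))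

/-- Two permutations move no common edge. -/
def EdgeDisjoint (g h : Perm (Fin n)) : Prop := ∀ e, MovesEdge g e → ¬MovesEdge h e

theorem EdgeDisjoint.symm {g h : Perm (Fin n)} (H : EdgeDisjoint g h) : EdgeDisjoint h g :=
  fun e h1 h2 => H e h2 h1

theorem EdgeDisjoint.preservesInitial {g h : Perm (Fin n)} (H : EdgeDisjoint g h) {e : Fin n}
    (he : MovesEdge g e) : PreservesInitial h e ∧ PreservesInitial h (e + 1) := by
  simpa [MovesEdge, not_or] using H e he

theorem EdgeDisjoint.commute {g h : Perm (Fin n)} (H : EdgeDisjoint g h) : Commute g h := by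
  refine Perm.Disjoint.commute fun e => ?_
  by_cases he : MovesEdge g e
  · exact Or.inr (apply_eq_of_not_movesEdge (H e he))
  · exact Or.inl (apply_eq_of_not_movesEdge he)

end SymmetricGroup

/-! ### Light-cone coordinates of the underlying vectors -/

section Cone

/-- The open cone about the positive horizontal axis bounded by the two diagonals. -/
def Rightward (p : ℝ × ℝ) : Prop := 0 < p.1 + p.2 ∧ 0 < p.1 - p.2

/-- The closed cone about the positive horizontal axis bounded by the two diagonals. -/
def WeaklyRightward (p : ℝ × ℝ) : Prop := 0 ≤ p.1 + p.2 ∧ 0 ≤ p.1 - p.2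

/-- The closed cone about the positive vertical axis bounded by the two diagonals. -/
def Upward (p : ℝ × ℝ) : Prop := 0 ≤ p.2 + p.1 ∧ 0 ≤ p.2 - p.1

theorem Rightward.weaklyRightward {p : ℝ × ℝ} (h : Rightward p) : WeaklyRightward p :=
  ⟨h.1.le, h.2.le⟩

theorem WeaklyRightward.zero : WeaklyRightward 0 := by simp [WeaklyRightward]

theorem Rightward.add_weaklyRightward {p q : ℝ × ℝ} (hp : Rightward p) (hq : WeaklyRightward q) :
    Rightward (p + q) := by
  simp only [Rightward, WeaklyRightward, Prod.fst_add, Prod.snd_add] at *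
  constructor <;> linarith

theorem WeaklyRightward.add {p q : ℝ × ℝ} (hp : WeaklyRightward p) (hq : WeaklyRightward q) :
    WeaklyRightward (p + q) := by
  simp only [WeaklyRightward, Prod.fst_add, Prod.snd_add] at *
  constructor <;> linarith

theorem Rightward.smul {p : ℝ × ℝ} (hp : Rightward p) {u : ℝ} (hu : 0 < u) :
    Rightward (u • p) := by
  simp only [Rightward, Prod.smul_fst, Prod.smul_snd, smul_eq_mul] at *
  constructor <;> nlinarith

theorem WeaklyRightward.smul {p : ℝ × ℝ} (hp : WeaklyRightward p) {u : ℝ} (hu : 0 ≤ u) :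
    WeaklyRightward (u • p) := by
  simp only [WeaklyRightward, Prod.smul_fst, Prod.smul_snd, smul_eq_mul] at *
  constructor <;> nlinarith

theorem Rightward.ne_zero {p : ℝ × ℝ} (hp : Rightward p) : p ≠ 0 := by
  rintro rfl
  simp [Rightward] at hp

theorem Rightward.not_upward {p : ℝ × ℝ} (hp : Rightward p) : ¬Upward p := by
  intro h
  simp only [Rightward, Upward] at *
  linarith

theorem Rightward.not_upward_neg {p : ℝ × ℝ} (hp : Rightward p) : ¬Upward (-p) := by
  intro h
  simp only [Rightward, Upward, Prod.fst_neg, Prod.snd_neg] at *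
  linarith

theorem Upward.add {p q : ℝ × ℝ} (hp : Upward p) (hq : Upward q) : Upward (p + q) := by
  simp only [Upward, Prod.fst_add, Prod.snd_add] at *
  constructor <;> linarith

theorem Upward.smul {p : ℝ × ℝ} (hp : Upward p) {u : ℝ} (hu : 0 ≤ u) : Upward (u • p) := by
  simp only [Upward, Prod.smul_fst, Prod.smul_snd, smul_eq_mul] at *
  constructor <;> nlinarith

/-- Rightward vectors stay so after a small perturbation in a given direction. -/
theorem Rightward.exists_add_smul {p : ℝ × ℝ} (hp : Rightward p) (d : ℝ × ℝ) :
    ∃ u : ℝ, 0 < u ∧ u < 1 ∧ Rightward (p + u • d) := by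
  have hopen : IsOpen {q : ℝ × ℝ | Rightward q} :=
    (isOpen_lt continuous_const (by fun_prop : Continuous fun q : ℝ × ℝ => q.1 + q.2)).inter
      (isOpen_lt continuous_const (by fun_prop : Continuous fun q : ℝ × ℝ => q.1 - q.2))
  have hcont : Continuous fun u : ℝ => p + u • d := by fun_prop
  have h0 : ∀ᶠ u in nhds (0 : ℝ), Rightward (p + u • d) :=
    (hopen.preimage hcont).mem_nhds (by simpa using hp)
  have h1 : ∀ᶠ u in nhdsWithin (0 : ℝ) (Set.Ioi 0), Rightward (p + u • d) :=
    h0.filter_mono nhdsWithin_le_nhds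
  obtain ⟨u, hu, hu'⟩ := (h1.and (Ioo_mem_nhdsGT one_pos)).exists
  exact ⟨u, hu'.1, hu'.2, hu⟩

variable {n : ℕ} {α : ℝ}

theorem underlyingVector_angle_mem (hα : α ∈ Set.Ico (Real.pi / 4) (Real.pi / 2)) (k : Fin n) :
    ((k : ℕ) : ℝ) * (Real.pi - 2 * α) / ((n : ℝ) - 1) + α ∈
      Set.Icc (Real.pi / 4) (3 * Real.pi / 4) := by
  obtain ⟨h1, h2⟩ := hα
  have hk : ((k : ℕ) : ℝ) ≤ (n : ℝ) - 1 := by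
    have : ((k : ℕ) : ℝ) + 1 ≤ n := by exact_mod_cast k.2
    linarith
  have hk0 : (0 : ℝ) ≤ ((k : ℕ) : ℝ) := by positivity
  -- For `n = 1` this quotient is 0/0 = 0, and the angle is α.
  have hq : ((k : ℕ) : ℝ) / ((n : ℝ) - 1) ≤ 1 := div_le_one_of_le₀ hk (hk0.trans hk)
  have hq0 : 0 ≤ ((k : ℕ) : ℝ) / ((n : ℝ) - 1) := div_nonneg hk0 (hk0.trans hk)
  rw [mul_div_right_comm ((k : ℕ) : ℝ)]
  have h3 : 0 ≤ Real.pi - 2 * α := by linarith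
  have h4 := mul_nonneg hq0 h3
  have h5 := mul_le_mul_of_nonneg_right hq h3
  constructor <;> linarith

/-- Up to √2, the coordinates along the diagonals are `sin` and `-cos` of `θ - π/4`, both increasing
on the range [0, π/2] that occurs. -/
theorem cos_sin_sub_pi_div_four (θ : ℝ) :
    -Real.cos θ + Real.sin θ = Real.sqrt 2 * Real.sin (θ - Real.pi / 4) ∧
      -Real.cos θ - Real.sin θ = -(Real.sqrt 2 * Real.cos (θ - Real.pi / 4)) := by
  have h : Real.sqrt 2 * Real.sqrt 2 = 2 := Real.mul_self_sqrt two_pos.le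
  rw [Real.sin_sub, Real.cos_sub, Real.cos_pi_div_four, Real.sin_pi_div_four]
  constructor
  · linear_combination (Real.cos θ / 2 - Real.sin θ / 2) * h
  · linear_combination (Real.cos θ / 2 + Real.sin θ / 2) * h

theorem upward_underlyingVector (hα : α ∈ Set.Ico (Real.pi / 4) (Real.pi / 2)) (k : Fin n) :
    Upward (underlyingVector n α k) := by
  have h := underlyingVector_angle_mem hα k
  simp only [underlyingVector, Upward]
  generalize ((k : ℕ) : ℝ) * (Real.pi - 2 * α) / ((n : ℝ) - 1) + α = θ at h
  obtain ⟨h1, h2⟩ := cos_sin_sub_pi_div_four θ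
  have h3 : 0 ≤ Real.sqrt 2 * Real.sin (θ - Real.pi / 4) :=
    mul_nonneg (Real.sqrt_nonneg _)
      (Real.sin_nonneg_of_nonneg_of_le_pi (by linarith [h.1]) (by linarith [h.2, Real.pi_pos]))
  have h4 : 0 ≤ Real.sqrt 2 * Real.cos (θ - Real.pi / 4) :=
    mul_nonneg (Real.sqrt_nonneg _)
      (Real.cos_nonneg_of_mem_Icc
        ⟨by linarith [h.1, Real.pi_pos], by linarith [h.2, Real.pi_pos]⟩)
  constructor <;> linarith

theorem rightward_underlyingVector_sub (hα : α ∈ Set.Ico (Real.pi / 4) (Real.pi / 2))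
    {a b : Fin n} (hab : a < b) :
    Rightward (underlyingVector n α b - underlyingVector n α a) := by
  have ha := underlyingVector_angle_mem hα a
  have hb := underlyingVector_angle_mem hα b
  have hlt : ((a : ℕ) : ℝ) * (Real.pi - 2 * α) / ((n : ℝ) - 1) + α <
      ((b : ℕ) : ℝ) * (Real.pi - 2 * α) / ((n : ℝ) - 1) + α := by
    have h1 : ((a : ℕ) : ℝ) < ((b : ℕ) : ℝ) := by exact_mod_cast hab
    have h2 : (0 : ℝ) ≤ ((a : ℕ) : ℝ) := by positivity
    have h3 : ((b : ℕ) : ℝ) + 1 ≤ n := by exact_mod_cast b.2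
    have h4 : 0 < Real.pi - 2 * α := by linarith [hα.2]
    have h5 : 0 < (n : ℝ) - 1 := by linarith
    gcongr
  simp only [underlyingVector, Rightward, Prod.fst_sub, Prod.snd_sub]
  generalize ((a : ℕ) : ℝ) * (Real.pi - 2 * α) / ((n : ℝ) - 1) + α = θ at *
  generalize ((b : ℕ) : ℝ) * (Real.pi - 2 * α) / ((n : ℝ) - 1) + α = η at *
  obtain ⟨h1, h2⟩ := cos_sin_sub_pi_div_four θ
  obtain ⟨h3, h4⟩ := cos_sin_sub_pi_div_four η
  have hs : 0 < Real.sqrt 2 := Real.sqrt_pos.2 two_pos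
  have h5 : Real.sin (θ - Real.pi / 4) < Real.sin (η - Real.pi / 4) :=
    Real.sin_lt_sin_of_lt_of_le_pi_div_two (by linarith [ha.1, Real.pi_pos])
      (by linarith [hb.2]) (by linarith)
  have h6 : Real.cos (η - Real.pi / 4) < Real.cos (θ - Real.pi / 4) :=
    Real.cos_lt_cos_of_nonneg_of_le_pi (by linarith [ha.1])
      (by linarith [hb.2, Real.pi_pos]) (by linarith)
  constructor <;> nlinarith

end Cone

/-! ### Borders -/

section Border

open Equiv

variable {n : ℕ} {α : ℝ}

theorem borderVertex_succ (σ : Perm (Fin n)) (e : Fin n) :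
    borderVertex α σ (e + 1) = borderVertex α σ e + underlyingVector n α (σ e) := by
  have h : Finset.univ.filter (fun i : Fin n => (i : ℕ) < e + 1) =
      insert e (Finset.univ.filter fun i : Fin n => (i : ℕ) < e) := by
    ext i
    simp [Fin.ext_iff]
    omega
  rw [borderVertex, h, Finset.sum_insert (by simp), add_comm, borderVertex]

theorem borderVertex_mul_of_preservesInitial (σ : Perm (Fin n)) {g : Perm (Fin n)} {k : ℕ}
    (hg : PreservesInitial g k) : borderVertex α (σ * g) k = borderVertex α σ k :=
  Finset.sum_equiv g (fun i => by simpa using (hg i).symm) fun i _ => rfl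

theorem preservesInitial_swap {i j : Fin n} {k : ℕ} (h : (i : ℕ) < k ↔ (j : ℕ) < k) :
    PreservesInitial (swap i j) k := by
  intro m
  rw [swap_apply_def]
  split_ifs with h1 h2
  · rw [h1, h]
  · rw [h2, h]
  · rfl

theorem borderVertex_mul_swap (σ : Perm (Fin n)) {i j : Fin n} {k : ℕ} (hi : (i : ℕ) < k)
    (hj : k ≤ (j : ℕ)) :
    borderVertex α (σ * swap i j) k - borderVertex α σ k =
      underlyingVector n α (σ j) - underlyingVector n α (σ i) := by
  have hmem : i ∈ Finset.univ.filter (fun m : Fin n => (m : ℕ) < k) := by simpa using hi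
  rw [borderVertex, borderVertex, ← Finset.add_sum_erase _ _ hmem,
    ← Finset.add_sum_erase _ (fun m => underlyingVector n α (σ m)) hmem]
  have h : ∑ m ∈ (Finset.univ.filter (fun m : Fin n => (m : ℕ) < k)).erase i,
      underlyingVector n α ((σ * swap i j) m) =
      ∑ m ∈ (Finset.univ.filter (fun m : Fin n => (m : ℕ) < k)).erase i,
      underlyingVector n α (σ m) := by
    refine Finset.sum_congr rfl fun m hm => ?_
    rw [Finset.mem_erase, Finset.mem_filter] at hm
    rw [Perm.mul_apply, swap_apply_of_ne_of_ne hm.1]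
    rintro rfl
    omega
  rw [h, Perm.mul_apply, swap_apply_left]
  abel

/-- Each vertex of the border of `σ * g` is either a vertex of the border of `σ`, for the reason
that `g` preserves the initial segment in question, or lies to the right of the corresponding
vertex of the border of `σ`. -/
def Advances (α : ℝ) (σ g : Perm (Fin n)) : Prop :=
  ∀ k, PreservesInitial g k ∨ Rightward (borderVertex α (σ * g) k - borderVertex α σ k)

theorem Advances.weaklyRightward {σ g : Perm (Fin n)} (h : Advances α σ g) (k : ℕ) :
    WeaklyRightward (borderVertex α (σ * g) k - borderVertex α σ k) := by
  rcases h k with h | h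
  · rw [borderVertex_mul_of_preservesInitial σ h, sub_self]
    exact WeaklyRightward.zero
  · exact h.weaklyRightward

theorem Advances.rightward {σ g : Perm (Fin n)} (h : Advances α σ g) {k : ℕ}
    (hk : ¬PreservesInitial g k) :
    Rightward (borderVertex α (σ * g) k - borderVertex α σ k) :=
  (h k).resolve_left hk

theorem Advances.mul {σ g g' : Perm (Fin n)} (h : Advances α σ g) (h' : Advances α (σ * g) g') :
    Advances α σ (g * g') := by
  intro k
  have h1 : borderVertex α (σ * (g * g')) k - borderVertex α σ k =
      (borderVertex α (σ * g * g') k - borderVertex α (σ * g) k) +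
        (borderVertex α (σ * g) k - borderVertex α σ k) := by
    rw [mul_assoc]; abel
  rw [h1]
  rcases h k with hk | hk
  · rcases h' k with hk' | hk'
    · exact Or.inl (hk.mul hk')
    · exact Or.inr (hk'.add_weaklyRightward (h.weaklyRightward k))
  · rw [add_comm]
    exact Or.inr (hk.add_weaklyRightward (h'.weaklyRightward k))

theorem BruhatStep.advances (hα : α ∈ Set.Ico (Real.pi / 4) (Real.pi / 2))
    {σ τ : Perm (Fin n)} (h : BruhatStep σ τ) : Advances α σ (σ⁻¹ * τ) := by
  obtain ⟨i, j, hij, hlt, rfl⟩ := h.exists_swap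
  rw [inv_mul_cancel_left]
  intro k
  by_cases hk : (i : ℕ) < k ∧ k ≤ (j : ℕ)
  · rw [borderVertex_mul_swap σ hk.1 hk.2]
    exact Or.inr (rightward_underlyingVector_sub hα hlt)
  · rw [Fin.lt_def] at hij
    exact Or.inl (preservesInitial_swap (by omega))

theorem BruhatLT.advances (hα : α ∈ Set.Ico (Real.pi / 4) (Real.pi / 2))
    {σ τ : Perm (Fin n)} (h : BruhatLT σ τ) : Advances α σ (σ⁻¹ * τ) := by
  induction h with
  | single h => exact h.advances hα
  | @tail ρ τ _ h ih =>
    have h1 := ih.mul (g' := ρ⁻¹ * τ) (by rw [mul_inv_cancel_left]; exact h.advances hα)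
    rwa [mul_assoc, mul_inv_cancel_left] at h1

/-! ### Points of borders and their comparison from left to right -/

/-- The point of the edge `e` of the border of `σ` with parameter `u`. -/
noncomputable def edgePoint (α : ℝ) (σ : Perm (Fin n)) (e : Fin n) (u : ℝ) : ℝ × ℝ :=
  borderVertex α σ e + u • underlyingVector n α (σ e)

theorem edgePoint_eq (σ : Perm (Fin n)) (e : Fin n) (u : ℝ) :
    edgePoint α σ e u = (1 - u) • borderVertex α σ e + u • borderVertex α σ (e + 1) := by
  rw [edgePoint, borderVertex_succ]
  module

theorem mem_border {σ : Perm (Fin n)} {p : ℝ × ℝ} :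
    p ∈ border α σ ↔ ∃ e : Fin n, ∃ u ∈ Set.Icc (0 : ℝ) 1, edgePoint α σ e u = p := by
  simp only [border, Set.mem_iUnion, segment_eq_image, Set.mem_image, edgePoint_eq]

theorem edgePoint_mem_border (σ : Perm (Fin n)) (e : Fin n) {u : ℝ}
    (hu : u ∈ Set.Icc (0 : ℝ) 1) : edgePoint α σ e u ∈ border α σ :=
  mem_border.2 ⟨e, u, hu, rfl⟩

theorem upward_borderVertex_sub (hα : α ∈ Set.Ico (Real.pi / 4) (Real.pi / 2))
    (σ : Perm (Fin n)) {j k : ℕ} (hjk : j ≤ k) :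
    Upward (borderVertex α σ k - borderVertex α σ j) := by
  have h : (Finset.univ.filter fun i : Fin n => (i : ℕ) < j) ⊆
      Finset.univ.filter fun i : Fin n => (i : ℕ) < k := by
    intro i
    simp only [Finset.mem_filter, Finset.mem_univ, true_and]
    omega
  rw [borderVertex, borderVertex, ← Finset.sum_sdiff h, add_sub_cancel_right]
  exact Finset.sum_induction _ Upward (fun _ _ => Upward.add) (by simp [Upward])
    fun i _ => upward_underlyingVector hα _

/-- The border climbs at least as steeply as the diagonals. -/
theorem upward_sub_or_upward_sub (hα : α ∈ Set.Ico (Real.pi / 4) (Real.pi / 2))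
    {σ : Perm (Fin n)} {p q : ℝ × ℝ} (hp : p ∈ border α σ) (hq : q ∈ border α σ) :
    Upward (p - q) ∨ Upward (q - p) := by
  obtain ⟨e, u, hu, rfl⟩ := mem_border.1 hp
  obtain ⟨e', u', hu', rfl⟩ := mem_border.1 hq
  have key : ∀ {e e' : Fin n} {u u' : ℝ}, e < e' → u ∈ Set.Icc (0 : ℝ) 1 →
      u' ∈ Set.Icc (0 : ℝ) 1 → Upward (edgePoint α σ e' u' - edgePoint α σ e u) := by
    intro e e' u u' he hu hu'
    have h1 : edgePoint α σ e' u' - edgePoint α σ e u =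
        (borderVertex α σ e' - borderVertex α σ (e + 1)) +
          ((1 - u) • underlyingVector n α (σ e) + u' • underlyingVector n α (σ e')) := by
      rw [borderVertex_succ, edgePoint, edgePoint]
      module
    rw [h1]
    exact (upward_borderVertex_sub hα σ he).add
      (((upward_underlyingVector hα _).smul (by linarith [hu.2])).add
        ((upward_underlyingVector hα _).smul hu'.1))
  rcases lt_trichotomy e e' with h | rfl | h
  · exact Or.inr (key h hu hu')
  · have h1 : ∀ a b : ℝ, edgePoint α σ e a - edgePoint α σ e b =
        (a - b) • underlyingVector n α (σ e) := by
      intro a b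
      rw [edgePoint, edgePoint]
      module
    rw [h1, h1]
    rcases le_total u u' with h | h
    · exact Or.inr ((upward_underlyingVector hα _).smul (sub_nonneg.2 h))
    · exact Or.inl ((upward_underlyingVector hα _).smul (sub_nonneg.2 h))
  · exact Or.inl (key h hu' hu)

theorem not_rightward_sub (hα : α ∈ Set.Ico (Real.pi / 4) (Real.pi / 2))
    {σ : Perm (Fin n)} {p q : ℝ × ℝ} (hp : p ∈ border α σ) (hq : q ∈ border α σ) :
    ¬Rightward (p - q) := by
  intro h
  rcases upward_sub_or_upward_sub hα hp hq with h1 | h1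
  · exact h.not_upward h1
  · exact h.not_upward_neg (by rwa [neg_sub])

/-- The point `p` lies on the border of `σ` or to the right of it. -/
def WeaklyRightOf (α : ℝ) (σ : Perm (Fin n)) (p : ℝ × ℝ) : Prop :=
  ∃ q ∈ border α σ, WeaklyRightward (p - q)

theorem weaklyRightOf_of_mem {σ : Perm (Fin n)} {p : ℝ × ℝ} (hp : p ∈ border α σ) :
    WeaklyRightOf α σ p :=
  ⟨p, hp, by rw [sub_self]; exact WeaklyRightward.zero⟩

theorem not_weaklyRightOf (hα : α ∈ Set.Ico (Real.pi / 4) (Real.pi / 2))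
    {σ : Perm (Fin n)} {p q : ℝ × ℝ} (hq : q ∈ border α σ) (h : Rightward (q - p)) :
    ¬WeaklyRightOf α σ p := by
  rintro ⟨q', hq', h'⟩
  refine not_rightward_sub hα hq hq' ?_
  rw [← sub_add_sub_cancel q p q']
  exact h.add_weaklyRightward h'

theorem edgePoint_mul_sub (σ g : Perm (Fin n)) (e : Fin n) (u : ℝ) :
    edgePoint α (σ * g) e u - edgePoint α σ e u =
      (1 - u) • (borderVertex α (σ * g) e - borderVertex α σ e) +
        u • (borderVertex α (σ * g) (e + 1) - borderVertex α σ (e + 1)) := by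
  rw [edgePoint_eq, edgePoint_eq]
  module

theorem edgePoint_mul_of_not_movesEdge (σ : Perm (Fin n)) {g : Perm (Fin n)} {e : Fin n}
    (h : ¬MovesEdge g e) (u : ℝ) : edgePoint α (σ * g) e u = edgePoint α σ e u := by
  rw [MovesEdge, not_or, not_not, not_not] at h
  rw [edgePoint_eq, edgePoint_eq, borderVertex_mul_of_preservesInitial σ h.1,
    borderVertex_mul_of_preservesInitial σ h.2]

theorem Advances.weaklyRightward_edgePoint {σ g : Perm (Fin n)} (h : Advances α σ g) (e : Fin n)
    {u : ℝ} (hu : u ∈ Set.Icc (0 : ℝ) 1) :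
    WeaklyRightward (edgePoint α (σ * g) e u - edgePoint α σ e u) := by
  rw [edgePoint_mul_sub]
  exact ((h.weaklyRightward _).smul (by linarith [hu.2])).add ((h.weaklyRightward _).smul hu.1)

theorem Advances.rightward_edgePoint {σ g : Perm (Fin n)} (h : Advances α σ g) {e : Fin n}
    (he : MovesEdge g e) {u : ℝ} (hu : 0 < u) (hu' : u < 1) :
    Rightward (edgePoint α (σ * g) e u - edgePoint α σ e u) := by
  rw [edgePoint_mul_sub]
  rcases he with he | he
  · exact ((h.rightward he).smul (by linarith)).add_weaklyRightward
      ((h.weaklyRightward _).smul hu.le)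
  · rw [add_comm]
    exact ((h.rightward he).smul hu).add_weaklyRightward
      ((h.weaklyRightward _).smul (by linarith))

theorem Advances.edgePoint_eq_or_rightward {σ g : Perm (Fin n)} (h : Advances α σ g) (e : Fin n)
    {u : ℝ} (hu : u ∈ Set.Icc (0 : ℝ) 1) :
    edgePoint α (σ * g) e u = edgePoint α σ e u ∨
      Rightward (edgePoint α (σ * g) e u - edgePoint α σ e u) := by
  -- The end points need their own treatment: a moved edge may have one fixed end.
  rcases hu.1.eq_or_lt with rfl | h0
  · simp only [edgePoint, zero_smul, add_zero]
    rcases h e with h1 | h1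
    · exact Or.inl (borderVertex_mul_of_preservesInitial σ h1)
    · exact Or.inr h1
  rcases hu.2.eq_or_lt with rfl | h1
  · simp only [edgePoint, one_smul, ← borderVertex_succ]
    rcases h (e + 1) with h1 | h1
    · exact Or.inl (borderVertex_mul_of_preservesInitial σ h1)
    · exact Or.inr h1
  by_cases he : MovesEdge g e
  · exact Or.inr (h.rightward_edgePoint he h0 h1)
  · exact Or.inl (edgePoint_mul_of_not_movesEdge σ he u)

theorem WeaklyRightOf.of_advances {σ g : Perm (Fin n)} (h : Advances α σ g) {p : ℝ × ℝ}
    (hp : WeaklyRightOf α (σ * g) p) : WeaklyRightOf α σ p := by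
  obtain ⟨q, hq, hpq⟩ := hp
  obtain ⟨e, u, hu, rfl⟩ := mem_border.1 hq
  refine ⟨_, edgePoint_mem_border σ e hu, ?_⟩
  rw [← sub_add_sub_cancel p (edgePoint α (σ * g) e u)]
  exact hpq.add (h.weaklyRightward_edgePoint e hu)

/-- A point of the border of `σ` which is not to the left of the border of `σ * g` is on it. -/
theorem Advances.mem_border (hα : α ∈ Set.Ico (Real.pi / 4) (Real.pi / 2))
    {σ g : Perm (Fin n)} (h : Advances α σ g) {p : ℝ × ℝ}
    (hp : p ∈ border α σ) (hp' : WeaklyRightOf α (σ * g) p) : p ∈ border α (σ * g) := by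
  obtain ⟨e, u, hu, rfl⟩ := _root_.mem_border.1 hp
  have hq := edgePoint_mem_border (α := α) (σ * g) e hu
  rcases h.edgePoint_eq_or_rightward e hu with h1 | h1
  · rwa [← h1]
  · exact absurd hp' (not_weaklyRightOf hα hq h1)

/-- The border of `σ * g` is covered by those of `σ` and `σ * g * h`, if `g` and `h` move no
common edge. -/
theorem EdgeDisjoint.border_subset {g h : Perm (Fin n)} (H : EdgeDisjoint g h)
    (σ : Perm (Fin n)) : border α (σ * g) ⊆ border α σ ∪ border α (σ * g * h) := by
  intro p hp
  obtain ⟨e, u, hu, rfl⟩ := _root_.mem_border.1 hp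
  by_cases he : MovesEdge g e
  · rw [← edgePoint_mul_of_not_movesEdge (σ * g) (H e he)]
    exact Or.inr (edgePoint_mem_border _ e hu)
  · rw [edgePoint_mul_of_not_movesEdge σ he]
    exact Or.inl (edgePoint_mem_border _ e hu)

/-- The core of the comparison of two permutations `s` and `t`. If neither of the borders of
`σ * s` and `σ * g * t` is to the left of the other one along the common edges, where `g`
moves no edge moved by `s`, then `s` and `t` move some initial segment in the same way. -/
theorem exists_inv_mul_preservesInitial (hα : α ∈ Set.Ico (Real.pi / 4) (Real.pi / 2))
    {σ g s t : Perm (Fin n)} (hs : Advances α σ s) (ht : Advances α (σ * g) t)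
    (hsg : EdgeDisjoint s g) (hst : ¬EdgeDisjoint s t)
    (h : ∀ e, MovesEdge s e → MovesEdge t e → ∀ u : ℝ, 0 < u → u < 1 →
      WeaklyRightOf α (σ * g * t) (edgePoint α (σ * s) e u) ∧
        WeaklyRightOf α (σ * s) (edgePoint α (σ * g * t) e u)) :
    ∃ k, ¬PreservesInitial s k ∧ ¬PreservesInitial t k ∧ PreservesInitial (t⁻¹ * s) k := by
  classical
  have hIcc : ∀ {u : ℝ}, 0 < u → u < 1 → u ∈ Set.Icc (0 : ℝ) 1 := fun h h' => ⟨h.le, h'.le⟩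
  have hex : ∃ m : ℕ, ∃ hm : m < n, MovesEdge s ⟨m, hm⟩ ∧ MovesEdge t ⟨m, hm⟩ := by
    simp only [EdgeDisjoint, not_forall, not_not] at hst
    obtain ⟨e, h1, h2⟩ := hst
    exact ⟨e, e.2, h1, h2⟩
  obtain ⟨hm, hs1, ht1⟩ := Nat.find_spec hex
  have hmin := fun m hlt => Nat.find_min hex (m := m) hlt
  generalize Nat.find hex = m at *
  set e : Fin n := ⟨m, hm⟩ with he
  obtain ⟨hg0, -⟩ := hsg.preservesInitial hs1
  -- The two borders start the edge `e` at the base border.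
  have hA : PreservesInitial s e → PreservesInitial t e := by
    intro hse
    by_contra hte
    have h1 : Rightward (borderVertex α (σ * g * t) e - borderVertex α (σ * s) e) := by
      rw [borderVertex_mul_of_preservesInitial σ hse,
        ← borderVertex_mul_of_preservesInitial σ hg0]
      exact ht.rightward hte
    -- The comparison is available only for `0 < u < 1`, so the gap at the vertex is carried to a
    -- small positive `u`.
    obtain ⟨u, hu0, hu1, hu⟩ := h1.exists_add_smul
      (underlyingVector n α ((σ * g * t) e) - underlyingVector n α ((σ * s) e))
    refine not_weaklyRightOf hα (edgePoint_mem_border (σ * g * t) e (hIcc hu0 hu1)) ?_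
      (h e hs1 ht1 u hu0 hu1).1
    convert hu using 1
    rw [edgePoint, edgePoint]
    module
  have hB : PreservesInitial t e → PreservesInitial s e := by
    intro hte
    by_contra hse
    have h1 : Rightward (borderVertex α (σ * s) e - borderVertex α (σ * g * t) e) := by
      rw [borderVertex_mul_of_preservesInitial _ hte,
        borderVertex_mul_of_preservesInitial σ hg0]
      exact hs.rightward hse
    obtain ⟨u, hu0, hu1, hu⟩ := h1.exists_add_smul
      (underlyingVector n α ((σ * s) e) - underlyingVector n α ((σ * g * t) e))
    refine not_weaklyRightOf hα (edgePoint_mem_border (σ * s) e (hIcc hu0 hu1)) ?_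
      (h e hs1 ht1 u hu0 hu1).2
    convert hu using 1
    rw [edgePoint, edgePoint]
    module
  -- Otherwise both move vertex `e`. Vertex 0 never moves, so edge `e - 1` would be an earlier
  -- common edge.
  have hse : PreservesInitial s e := by
    by_contra hse
    have hte : ¬PreservesInitial t e := fun h => hse (hB h)
    obtain _ | m := m
    · exact hse fun i => by simp [he]
    · exact hmin m (Nat.lt_succ_self m) ⟨by omega, Or.inr hse, Or.inr hte⟩
  have hte := hA hse
  have hse' : ¬PreservesInitial s (e + 1) := hs1.resolve_left (not_not.2 hse)
  have hte' : ¬PreservesInitial t (e + 1) := ht1.resolve_left (not_not.2 hte)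
  have hv : borderVertex α (σ * g * t) e = borderVertex α (σ * s) e := by
    rw [borderVertex_mul_of_preservesInitial σ hse,
      borderVertex_mul_of_preservesInitial _ hte, borderVertex_mul_of_preservesInitial σ hg0]
  -- The two edges start at the same point; if their indices differed, the midpoint of one would be
  -- strictly right of the other.
  have hdir : (σ * g * t) e = (σ * s) e := by
    have hsub : edgePoint α (σ * g * t) e (1 / 2) - edgePoint α (σ * s) e (1 / 2) =
        (1 / 2 : ℝ) • (underlyingVector n α ((σ * g * t) e) -
          underlyingVector n α ((σ * s) e)) := by
      rw [edgePoint, edgePoint, hv]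
      module
    have hhalf := h e hs1 ht1 (1 / 2) (by norm_num) (by norm_num)
    rcases lt_trichotomy ((σ * g * t) e) ((σ * s) e) with hlt | heq | hlt
    · refine absurd hhalf.2 (not_weaklyRightOf hα
        (edgePoint_mem_border (σ * s) e (hIcc (u := 1 / 2) (by norm_num) (by norm_num))) ?_)
      rw [← neg_sub, hsub, ← smul_neg, neg_sub]
      exact (rightward_underlyingVector_sub hα hlt).smul (by norm_num)
    · exact heq
    · refine absurd hhalf.1 (not_weaklyRightOf hα
        (edgePoint_mem_border (σ * g * t) e (hIcc (u := 1 / 2) (by norm_num) (by norm_num))) ?_)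
      rw [hsub]
      exact (rightward_underlyingVector_sub hα hlt).smul (by norm_num)
  -- Edge `s e` is also moved by `s`, hence not by `g`, so `g` can be cancelled.
  have hste : t e = s e := by
    have h1 : g (s e) = s e := apply_eq_of_not_movesEdge (hsg _ (movesEdge_apply hse hse'))
    have h2 : g (t e) = s e := σ.injective hdir
    exact g.injective (h2.trans h1.symm)
  refine ⟨e + 1, hse', hte', (hte.inv.mul hse).succ ?_⟩
  rw [Perm.mul_apply, ← hste]
  exact Equiv.symm_apply_apply t e

end Border

/-! ### Tilings -/

section Tiling

open Equiv

theorem EdgeDisjoint.one {n : ℕ} (g : Perm (Fin n)) : EdgeDisjoint g 1 := fun _ _ h =>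
  h.elim (· (PreservesInitial.one _)) (· (PreservesInitial.one _))

theorem EdgeDisjoint.mul {n : ℕ} {g h h' : Perm (Fin n)} (H : EdgeDisjoint g h)
    (H' : EdgeDisjoint g h') : EdgeDisjoint g (h * h') := fun _ he hm =>
  hm.elim (· ((H.preservesInitial he).1.mul (H'.preservesInitial he).1))
    (· ((H.preservesInitial he).2.mul (H'.preservesInitial he).2))

theorem List.exists_append_cons_of_not_forall {β : Type*} {p : β → Prop} {l : List β}
    (h : ¬∀ b ∈ l, p b) : ∃ l₁ b l₂, l = l₁ ++ b :: l₂ ∧ (∀ c ∈ l₁, p c) ∧ ¬p b := by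
  induction l with
  | nil => simp at h
  | cons a l ih =>
    by_cases ha : p a
    · obtain ⟨l₁, b, l₂, rfl, h1, h2⟩ := ih fun h' => h (List.forall_mem_cons.2 ⟨ha, h'⟩)
      exact ⟨a :: l₁, b, l₂, rfl, List.forall_mem_cons.2 ⟨ha, h1⟩, h2⟩
    · exact ⟨[], a, l, rfl, by simp, ha⟩

variable {B W : Type*} [Group W] {M : CoxeterMatrix B} (cs : CoxeterSystem M W)
  {n : ℕ} (φ : W →* Perm (Fin n)) (α : ℝ)

/-- The union of the borders of the elements on the path in the Cayley graph which starts at `x`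
and is labelled by the given word. -/
noncomputable def tilingFrom (x : W) : List B → Set (ℝ × ℝ)
  | [] => border α (φ x)
  | s :: ω => border α (φ x) ∪ tilingFrom (x * cs.simple s) ω

/-- Multiplication of `x` by the letters of the word one by one increases the length
each time. -/
def ReducedFrom (x : W) (ω : List B) : Prop :=
  cs.length (x * cs.wordProd ω) = cs.length x + ω.length

variable {cs φ α}

theorem tilingFrom_eq_iUnion (x : W) (ω : List B) :
    tilingFrom cs φ α x ω =
      ⋃ j ∈ Finset.range (ω.length + 1), border α (φ (x * cs.wordProd (ω.take j))) := by
  induction ω generalizing x with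
  | nil => simp [tilingFrom]
  | cons s ω ih =>
    rw [tilingFrom, ih]
    ext p
    simp only [Set.mem_union, Set.mem_iUnion, Finset.mem_range, List.length_cons, exists_prop]
    constructor
    · rintro (h | ⟨j, hj, h⟩)
      · exact ⟨0, by omega, by simpa using h⟩
      · exact ⟨j + 1, by omega, by simpa [cs.wordProd_cons, mul_assoc] using h⟩
    · rintro ⟨_ | j, hj, h⟩
      · exact Or.inl (by simpa using h)
      · exact Or.inr ⟨j, by omega, by simpa [cs.wordProd_cons, mul_assoc] using h⟩

theorem tiling_eq_tilingFrom (ω : List B) : tiling cs φ α ω = tilingFrom cs φ α 1 ω := by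
  simp [tilingFrom_eq_iUnion, tiling]

theorem border_subset_tilingFrom (x : W) (ω : List B) :
    border α (φ x) ⊆ tilingFrom cs φ α x ω := by
  cases ω with
  | nil => exact subset_rfl
  | cons s ω => exact Set.subset_union_left

theorem tilingFrom_append_congr {ω ω' : List B} (x : W) (l : List B)
    (h : tilingFrom cs φ α (x * cs.wordProd l) ω = tilingFrom cs φ α (x * cs.wordProd l) ω') :
    tilingFrom cs φ α x (l ++ ω) = tilingFrom cs φ α x (l ++ ω') := by
  induction l generalizing x with
  | nil => simpa using h
  | cons s l ih =>
    rw [List.cons_append, List.cons_append, tilingFrom, tilingFrom, ih]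
    rwa [mul_assoc, ← cs.wordProd_cons]

theorem ReducedFrom.of_cons {x : W} {s : B} {ω : List B} (h : ReducedFrom cs x (s :: ω)) :
    cs.length (x * cs.simple s) = cs.length x + 1 ∧ ReducedFrom cs (x * cs.simple s) ω := by
  simp only [ReducedFrom, List.length_cons, cs.wordProd_cons, ← mul_assoc] at h ⊢
  have h1 := cs.length_mul_le (x * cs.simple s) (cs.wordProd ω)
  have h2 := cs.length_mul_le x (cs.simple s)
  have h3 := cs.length_wordProd_le ω
  rw [cs.length_simple] at h2
  omega

theorem ReducedFrom.of_append {x : W} {l ω : List B} (h : ReducedFrom cs x (l ++ ω)) :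
    ReducedFrom cs (x * cs.wordProd l) ω := by
  induction l generalizing x with
  | nil => simpa using h
  | cons s l ih =>
    rw [cs.wordProd_cons, ← mul_assoc]
    exact ih h.of_cons.2

theorem IsEEmbedding.advances (hφ : IsEEmbedding cs φ)
    (hα : α ∈ Set.Ico (Real.pi / 4) (Real.pi / 2)) {x : W} {s : B}
    (h : cs.length (x * cs.simple s) = cs.length x + 1) :
    Advances α (φ x) (φ (cs.simple s)) := by
  have h1 := (hφ.weak_bruhat x _ (Relation.TransGen.single ⟨s, rfl, h⟩)).advances hα
  rwa [map_mul, inv_mul_cancel_left] at h1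

theorem IsEEmbedding.weaklyRightOf_of_mem_tilingFrom (hφ : IsEEmbedding cs φ)
    (hα : α ∈ Set.Ico (Real.pi / 4) (Real.pi / 2)) {x : W} {ω : List B}
    (h : ReducedFrom cs x ω) {p : ℝ × ℝ} (hp : p ∈ tilingFrom cs φ α x ω) :
    WeaklyRightOf α (φ x) p := by
  induction ω generalizing x with
  | nil => exact weaklyRightOf_of_mem hp
  | cons s ω ih =>
    rcases hp with hp | hp
    · exact weaklyRightOf_of_mem hp
    · refine WeaklyRightOf.of_advances (hφ.advances hα h.of_cons.1) ?_
      rw [← map_mul]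
      exact ih h.of_cons.2 hp

/-- Removing the first letter removes the points to the left of the second border. -/
theorem IsEEmbedding.tilingFrom_tail (hφ : IsEEmbedding cs φ)
    (hα : α ∈ Set.Ico (Real.pi / 4) (Real.pi / 2)) {x : W} {s : B} {ω : List B}
    (h : ReducedFrom cs x (s :: ω)) :
    tilingFrom cs φ α (x * cs.simple s) ω =
      {p ∈ tilingFrom cs φ α x (s :: ω) | WeaklyRightOf α (φ (x * cs.simple s)) p} := by
  ext p
  constructor
  · exact fun hp => ⟨Or.inr hp, hφ.weaklyRightOf_of_mem_tilingFrom hα h.of_cons.2 hp⟩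
  · rintro ⟨hp | hp, hp'⟩
    · refine border_subset_tilingFrom _ _ ?_
      rw [map_mul] at hp' ⊢
      exact (hφ.advances hα h.of_cons.1).mem_border hα hp hp'
    · exact hp

theorem EdgeDisjoint.map_wordProd {g : Perm (Fin n)} {l : List B}
    (hl : ∀ t ∈ l, EdgeDisjoint g (φ (cs.simple t))) :
    EdgeDisjoint g (φ (cs.wordProd l)) := by
  induction l with
  | nil => simpa using EdgeDisjoint.one g
  | cons t l ih =>
    rw [List.forall_mem_cons] at hl
    rw [cs.wordProd_cons, map_mul]
    exact hl.1.mul (ih hl.2)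

/-- A point to the right of an edge which is not moved by the first letters of a word can only be
reached by the remaining letters. -/
theorem mem_tilingFrom_of_append (hα : α ∈ Set.Ico (Real.pi / 4) (Real.pi / 2))
    {g : Perm (Fin n)} {e : Fin n} (he : MovesEdge g e) {u : ℝ} (hu : u ∈ Set.Icc (0 : ℝ) 1)
    {x : W} {l r : List B} (hl : ∀ t ∈ l, EdgeDisjoint g (φ (cs.simple t))) {p : ℝ × ℝ}
    (hp : Rightward (p - edgePoint α (φ x) e u)) (hmem : p ∈ tilingFrom cs φ α x (l ++ r)) :
    p ∈ tilingFrom cs φ α (x * cs.wordProd l) r := by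
  induction l generalizing x with
  | nil => simpa using hmem
  | cons t l ih =>
    rw [List.forall_mem_cons] at hl
    rw [cs.wordProd_cons, ← mul_assoc]
    -- The current border contains the point of the unmoved edge, so it cannot contain `p`, strictly
    -- to the right of that point.
    refine ih hl.2 ?_ (hmem.resolve_left fun h =>
      not_rightward_sub hα h (edgePoint_mem_border (φ x) e hu) hp)
    rwa [map_mul, edgePoint_mul_of_not_movesEdge _ (hl.1 e he)]

/-- Two simple reflections which move an initial segment do so in different ways. -/
theorem IsEEmbedding.not_preservesInitial_inv_mul (hφ : IsEEmbedding cs φ)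
    (hα : α ∈ Set.Ico (Real.pi / 4) (Real.pi / 2)) {s t : B} (hst : s ≠ t) {k : ℕ}
    (hs : ¬PreservesInitial (φ (cs.simple s)) k) (ht : ¬PreservesInitial (φ (cs.simple t)) k) :
    ¬PreservesInitial ((φ (cs.simple t))⁻¹ * φ (cs.simple s)) k := by
  intro h
  have hlen : cs.length (cs.simple t * cs.simple s) = cs.length (cs.simple t) + 1 := by
    refine (cs.length_mul_simple (cs.simple t) s).resolve_right fun h1 => hst ?_
    rw [cs.length_simple, Nat.add_eq_right, cs.length_eq_zero_iff, mul_eq_one_iff_eq_inv,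
      cs.inv_simple] at h1
    exact (cs.simple_injective h1).symm
  -- Vertex `k` moves strictly right from 1 to `t` and again from `t` to `ts`. But `t⁻¹ = t`, so by
  -- `h` the product `ts` leaves it where it was.
  have h1 := (hφ.advances hα hlen).rightward hs
  have h2 := (hφ.advances (x := 1) hα (s := t) (by simp)).rightward ht
  rw [map_one, one_mul] at h2
  rw [← map_inv, cs.inv_simple] at h
  have h3 := borderVertex_mul_of_preservesInitial (α := α) 1 h
  rw [one_mul] at h3
  rw [h3] at h1
  have h4 := h1.add_weaklyRightward h2.weaklyRightward
  rw [sub_add_sub_cancel, sub_self] at h4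
  exact h4.ne_zero rfl

theorem IsEEmbedding.map_simple_ne_one (hφ : IsEEmbedding cs φ) (s : B) :
    φ (cs.simple s) ≠ 1 := by
  intro h
  have h1 := cs.length_simple s
  rw [hφ.injective (h.trans (map_one φ).symm), cs.length_one] at h1
  exact zero_ne_one h1

/-- If a tiling can be started with the letter `s`, then every word for it contains `s`, and the
letters before `s` move no edge moved by `s`. -/
theorem IsEEmbedding.exists_eq_append_cons (hφ : IsEEmbedding cs φ)
    (hα : α ∈ Set.Ico (Real.pi / 4) (Real.pi / 2)) {x : W} {s : B} {ω ω' : List B}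
    (hω : ReducedFrom cs x ω) (hω' : ReducedFrom cs x (s :: ω'))
    (h : tilingFrom cs φ α x ω = tilingFrom cs φ α x (s :: ω')) :
    ∃ l r, ω = l ++ s :: r ∧
      ∀ t ∈ l, EdgeDisjoint (φ (cs.simple s)) (φ (cs.simple t)) := by
  have hs := hφ.advances hα hω'.of_cons.1
  have hmem : ∀ (e : Fin n) (u : ℝ), u ∈ Set.Icc (0 : ℝ) 1 →
      edgePoint α (φ x * φ (cs.simple s)) e u ∈ tilingFrom cs φ α x ω := by
    intro e u hu
    rw [h, ← map_mul]
    exact Or.inr (border_subset_tilingFrom _ _ (edgePoint_mem_border _ e hu))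
  by_cases hall : ∀ t ∈ ω, EdgeDisjoint (φ (cs.simple s)) (φ (cs.simple t))
  · exfalso
    obtain ⟨e, he⟩ := exists_movesEdge (hφ.map_simple_ne_one s)
    have hu : (1 / 2 : ℝ) ∈ Set.Icc (0 : ℝ) 1 := by norm_num
    have h1 := hs.rightward_edgePoint he (u := 1 / 2) (by norm_num) (by norm_num)
    have h2 := mem_tilingFrom_of_append (r := []) hα he hu hall h1
      (by rw [List.append_nil]; exact hmem e _ hu)
    refine not_rightward_sub hα h2 (edgePoint_mem_border _ e hu) ?_
    rwa [map_mul, edgePoint_mul_of_not_movesEdge _ (EdgeDisjoint.map_wordProd hall e he)]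
  · obtain ⟨l, t, r, rfl, hl, ht⟩ := List.exists_append_cons_of_not_forall hall
    refine ⟨l, r, ?_, hl⟩
    by_contra hne
    have hst : s ≠ t := by rintro rfl; exact hne rfl
    have hr := hω.of_append
    have hadv := hφ.advances hα hr.of_cons.1
    have hdis := EdgeDisjoint.map_wordProd hl
    rw [map_mul] at hadv
    -- The type of `hcomp` is fixed by its use: it is the mutual comparison along the edges moved by
    -- both `s` and `t`.
    suffices hcomp : _ by
      obtain ⟨k, hk1, hk2, hk3⟩ := exists_inv_mul_preservesInitial hα hs hadv hdis ht hcomp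
      exact hφ.not_preservesInitial_inv_mul hα hst hk1 hk2 hk3
    · intro e hes het u hu0 hu1
      have hu : u ∈ Set.Icc (0 : ℝ) 1 := ⟨hu0.le, hu1.le⟩
      constructor
      -- The points that `s` adds lie in the tiling of `ω`, but not on the borders up to the one
      -- just before `t`, which still contain the old edge; so they come at `t` or later.
      · have h1 := hs.rightward_edgePoint hes hu0 hu1
        have h2 := mem_tilingFrom_of_append hα hes hu hl h1 (hmem e u hu)
        rw [← map_mul, ← map_mul]
        refine hφ.weaklyRightOf_of_mem_tilingFrom hα hr.of_cons.2 (h2.resolve_left fun h3 => ?_)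
        refine not_rightward_sub hα h3 (edgePoint_mem_border _ e hu) ?_
        rwa [map_mul, edgePoint_mul_of_not_movesEdge _ (hdis e hes)]
      -- Symmetrically, the points made by `t` are strictly right of the border of `x`, so they
      -- belong to the part of the tiling of `s :: ω'` after `s`.
      · have h1 := hadv.rightward_edgePoint het hu0 hu1
        rw [edgePoint_mul_of_not_movesEdge _ (hdis e hes)] at h1
        have h2 : edgePoint α (φ x * φ (cs.wordProd l) * φ (cs.simple t)) e u ∈
            tilingFrom cs φ α x (s :: ω') := by
          rw [← h]
          have h3 := border_subset_tilingFrom (cs := cs) (φ := φ) (α := α)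
            (x * cs.wordProd l * cs.simple t) r
          have h4 : ∀ (y : W) (l' : List B),
              tilingFrom cs φ α (y * cs.wordProd l') (t :: r) ⊆
                tilingFrom cs φ α y (l' ++ t :: r) := by
            intro y l'
            induction l' generalizing y with
            | nil => simp
            | cons a l' ih =>
              rw [cs.wordProd_cons, ← mul_assoc]
              exact (ih _).trans Set.subset_union_right
          refine h4 x l (Or.inr (h3 ?_))
          rw [map_mul, map_mul]
          exact edgePoint_mem_border _ e hu
        rw [← map_mul φ x (cs.simple s)]
        exact hφ.weaklyRightOf_of_mem_tilingFrom hα hω'.of_cons.2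
          (h2.resolve_left fun h3 =>
            not_rightward_sub hα h3 (edgePoint_mem_border _ e hu) h1)

/-! ### Braid moves which preserve tilings -/

theorem IsEEmbedding.commute_of_edgeDisjoint (hφ : IsEEmbedding cs φ) {s t : B}
    (h : EdgeDisjoint (φ (cs.simple s)) (φ (cs.simple t))) :
    Commute (cs.simple s) (cs.simple t) :=
  hφ.injective (by rw [map_mul, map_mul]; exact h.commute.eq)

theorem IsEEmbedding.ne_of_edgeDisjoint (hφ : IsEEmbedding cs φ) {s t : B}
    (h : EdgeDisjoint (φ (cs.simple s)) (φ (cs.simple t))) : s ≠ t := by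
  rintro rfl
  obtain ⟨e, he⟩ := exists_movesEdge (hφ.map_simple_ne_one s)
  exact h e he he

/-- The two paths differ only in their middle border, and this is covered by the borders before and
after it. -/
theorem IsEEmbedding.tilingFrom_swap (hφ : IsEEmbedding cs φ) {s t : B}
    (h : EdgeDisjoint (φ (cs.simple s)) (φ (cs.simple t))) (x : W) (ω : List B) :
    tilingFrom cs φ α x (s :: t :: ω) = tilingFrom cs φ α x (t :: s :: ω) := by
  have key : ∀ {s t : B}, EdgeDisjoint (φ (cs.simple s)) (φ (cs.simple t)) →
      tilingFrom cs φ α x (s :: t :: ω) ⊆ tilingFrom cs φ α x (t :: s :: ω) := by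
    intro s t h
    have hc : x * cs.simple t * cs.simple s = x * cs.simple s * cs.simple t := by
      rw [mul_assoc, mul_assoc, (hφ.commute_of_edgeDisjoint h).eq]
    rw [tilingFrom, tilingFrom, tilingFrom, tilingFrom, hc]
    refine Set.union_subset Set.subset_union_left (Set.union_subset ?_ ?_)
    · have h1 := h.border_subset (α := α) (φ x)
      rw [← map_mul, ← map_mul] at h1
      exact h1.trans (Set.union_subset_union_right _
        ((border_subset_tilingFrom _ _).trans Set.subset_union_right))
    · exact Set.subset_union_right.trans Set.subset_union_right
  exact (key h).antisymm (key h.symm)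

theorem braidWord_eq_pair {s t : B} (h : M s t = 2) : CoxeterSystem.braidWord M s t = [s, t] := by
  simp [CoxeterSystem.braidWord, h, CoxeterSystem.alternatingWord]

theorem IsEEmbedding.matrix_eq_two (hφ : IsEEmbedding cs φ) {s t : B}
    (h : EdgeDisjoint (φ (cs.simple s)) (φ (cs.simple t))) : M s t = 2 :=
  cs.matrix_eq_two_of_commute (hφ.ne_of_edgeDisjoint h) (hφ.commute_of_edgeDisjoint h)

theorem IsEEmbedding.mem_preservingPairs (hφ : IsEEmbedding cs φ) {s t : B}
    (h : EdgeDisjoint (φ (cs.simple s)) (φ (cs.simple t))) :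
    s(s, t) ∈ preservingPairs cs φ α := by
  intro a b hab x y _
  have h' : EdgeDisjoint (φ (cs.simple a)) (φ (cs.simple b)) := by
    rcases Sym2.eq_iff.1 hab with ⟨rfl, rfl⟩ | ⟨rfl, rfl⟩
    · exact h
    · exact h.symm
  rw [braidWord_eq_pair (hφ.matrix_eq_two h'), braidWord_eq_pair (hφ.matrix_eq_two h'.symm),
    tiling_eq_tilingFrom, tiling_eq_tilingFrom, List.append_assoc, List.append_assoc]
  exact tilingFrom_append_congr 1 x (hφ.tilingFrom_swap h' _ y)

theorem BraidMove.cons {J : Set (Sym2 B)} (a : B) {ω ω' : List B} (h : BraidMove M J ω ω') :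
    BraidMove M J (a :: ω) (a :: ω') := by
  obtain ⟨r, s, x, y, hJ, rfl, rfl⟩ := h
  exact ⟨r, s, a :: x, y, hJ, rfl, rfl⟩

theorem eqvGen_braidMove_cons {J : Set (Sym2 B)} (a : B) {ω ω' : List B}
    (h : Relation.EqvGen (BraidMove M J) ω ω') :
    Relation.EqvGen (BraidMove M J) (a :: ω) (a :: ω') := by
  induction h with
  | rel _ _ h => exact .rel _ _ (h.cons a)
  | refl => exact .refl _
  | symm _ _ _ ih => exact .symm _ _ ih
  | trans _ _ _ _ _ ih ih' => exact .trans _ _ _ ih ih'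

/-- A letter can be moved to the front past letters which move no common edge; this changes
neither the tiling nor the element. -/
theorem IsEEmbedding.move_to_front (hφ : IsEEmbedding cs φ) {s : B} {l r : List B}
    (hl : ∀ t ∈ l, EdgeDisjoint (φ (cs.simple s)) (φ (cs.simple t))) (x : W) :
    Relation.EqvGen (BraidMove M (preservingPairs cs φ α)) (l ++ s :: r) (s :: (l ++ r)) ∧
      tilingFrom cs φ α x (l ++ s :: r) = tilingFrom cs φ α x (s :: (l ++ r)) ∧
      cs.wordProd (l ++ s :: r) = cs.wordProd (s :: (l ++ r)) := by
  induction l generalizing x with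
  | nil => exact ⟨.refl _, rfl, rfl⟩
  | cons t l ih =>
    rw [List.forall_mem_cons] at hl
    obtain ⟨h1, h2, h3⟩ := ih hl.2 (x * cs.simple t)
    refine ⟨.trans _ _ _ (eqvGen_braidMove_cons t h1) (.rel _ _ ⟨t, s, [], l ++ r,
      hφ.mem_preservingPairs hl.1.symm, ?_, ?_⟩), ?_, ?_⟩
    · simp [braidWord_eq_pair (hφ.matrix_eq_two hl.1.symm)]
    · simp [braidWord_eq_pair (hφ.matrix_eq_two hl.1)]
    · rw [List.cons_append, tilingFrom, h2, List.cons_append, hφ.tilingFrom_swap hl.1]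
      rfl
    · rw [List.cons_append, cs.wordProd_cons, h3, List.cons_append]
      simp only [cs.wordProd_cons, ← mul_assoc]
      rw [(hφ.commute_of_edgeDisjoint hl.1).eq]

/-- Reduced words with the same tiling are connected by tiling-preserving braid moves. -/
theorem IsEEmbedding.eqvGen_braidMove_of_tilingFrom_eq (hφ : IsEEmbedding cs φ)
    (hα : α ∈ Set.Ico (Real.pi / 4) (Real.pi / 2)) {x : W} {ω ω' : List B}
    (hω : ReducedFrom cs x ω) (hω' : ReducedFrom cs x ω')
    (h : tilingFrom cs φ α x ω = tilingFrom cs φ α x ω') :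
    Relation.EqvGen (BraidMove M (preservingPairs cs φ α)) ω ω' := by
  induction ω' generalizing x ω with
  | nil =>
    cases ω with
    | nil => exact .refl _
    | cons s ω =>
      obtain ⟨l, r, h1, -⟩ := hφ.exists_eq_append_cons hα hω' hω h.symm
      simp at h1
  | cons s ω' ih =>
    obtain ⟨l, r, rfl, hl⟩ := hφ.exists_eq_append_cons hα hω hω' h
    obtain ⟨h1, h2, h3⟩ := hφ.move_to_front (α := α) (r := r) hl x
    have hred : ReducedFrom cs x (s :: (l ++ r)) := by
      rw [ReducedFrom, ← h3, hω]
      simp only [List.length_append, List.length_cons]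
      omega
    refine .trans _ _ _ h1 (eqvGen_braidMove_cons s (ih hred.of_cons.2 hω'.of_cons.2 ?_))
    -- Both tails are cut out of the same tiling by the same border, that of `x * s`.
    rw [hφ.tilingFrom_tail hα hred, hφ.tilingFrom_tail hα hω', ← h2, h]

/-! ### From braid moves on lists to classes of reduced words -/

theorem BraidMove.wordProd_eq {J : Set (Sym2 B)} {ω ω' : List B} (h : BraidMove M J ω ω') :
    cs.wordProd ω = cs.wordProd ω' := by
  obtain ⟨r, s, x, y, -, rfl, rfl⟩ := h
  simp only [cs.wordProd_append, cs.wordProd_braidWord_eq]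

theorem BraidMove.length_eq {J : Set (Sym2 B)} {ω ω' : List B} (h : BraidMove M J ω ω') :
    ω.length = ω'.length := by
  obtain ⟨r, s, x, y, -, rfl, rfl⟩ := h
  simp [CoxeterSystem.braidWord, M.symmetric r s]

/-- Braid moves starting at a reduced word of `w` stay among the reduced words of `w`. -/
theorem eqvGen_reducedWord {J : Set (Sym2 B)} {w : W} {ω ω' : List B}
    (h : Relation.EqvGen (BraidMove M J) ω ω') :
    ((cs.IsReduced ω ∧ cs.wordProd ω = w) ↔ (cs.IsReduced ω' ∧ cs.wordProd ω' = w)) ∧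
      ∀ (hω : cs.IsReduced ω ∧ cs.wordProd ω = w) (hω' : cs.IsReduced ω' ∧ cs.wordProd ω' = w),
        (braidSetoid cs J w).r ⟨ω, hω⟩ ⟨ω', hω'⟩ := by
  induction h with
  | rel ω ω' h =>
    refine ⟨?_, fun hω hω' => Relation.EqvGen.rel _ _ h⟩
    rw [CoxeterSystem.IsReduced, CoxeterSystem.IsReduced, h.wordProd_eq (cs := cs), h.length_eq]
  | refl => exact ⟨Iff.rfl, fun _ _ => Relation.EqvGen.refl _⟩
  | symm _ _ _ ih => exact ⟨ih.1.symm, fun hω hω' => Relation.EqvGen.symm _ _ (ih.2 hω' hω)⟩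
  -- The equivalence in the first component supplies the reducedness of the intermediate word.
  | trans _ _ _ _ _ ih ih' =>
    exact ⟨ih.1.trans ih'.1, fun hω hω' =>
      Relation.EqvGen.trans _ _ _ (ih.2 hω (ih.1.1 hω)) (ih'.2 (ih.1.1 hω) hω')⟩

theorem tiling_eq_of_braidSetoid {w : W} {ω ω' : ReducedWord cs w}
    (h : (braidSetoid cs (preservingPairs cs φ α) w).r ω ω') :
    tiling cs φ α ω.1 = tiling cs φ α ω'.1 := by
  induction h with
  | rel ω ω' h =>
    obtain ⟨r, s, x, y, hJ, h1, h2⟩ := h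
    rw [h1, h2]
    exact hJ r s rfl x y (h1 ▸ ω.2.1)
  | refl => rfl
  | symm _ _ _ ih => exact ih.symm
  | trans _ _ _ _ _ ih ih' => exact ih.trans ih'

theorem IsEEmbedding.tiling_eq_iff (hφ : IsEEmbedding cs φ)
    (hα : α ∈ Set.Ico (Real.pi / 4) (Real.pi / 2)) {w : W} (ω ω' : ReducedWord cs w) :
    tiling cs φ α ω.1 = tiling cs φ α ω'.1 ↔
      (braidSetoid cs (preservingPairs cs φ α) w).r ω ω' := by
  refine ⟨fun h => ?_, tiling_eq_of_braidSetoid⟩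
  rw [tiling_eq_tilingFrom, tiling_eq_tilingFrom] at h
  have hred : ∀ ω : ReducedWord cs w, ReducedFrom cs 1 ω.1 := fun ω => by
    rw [ReducedFrom, one_mul, cs.length_one, zero_add]
    exact ω.2.1
  exact (eqvGen_reducedWord
    (hφ.eqvGen_braidMove_of_tilingFrom_eq hα (hred ω) (hred ω') h)).2 ω.2 ω'.2

end Tiling

/-! ### The bijection -/

theorem theorem2 {B W : Type*} [Group W] [Finite W] {M : CoxeterMatrix B}
    (cs : CoxeterSystem M W) {n : ℕ} (φ : W →* Equiv.Perm (Fin n)) (hφ : IsEEmbedding cs φ)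
    (α : ℝ) (hα : α ∈ Set.Ico (Real.pi / 4) (Real.pi / 2)) (w : W) :
    ∃ f : tilingSet cs φ α w → BraidClasses cs (preservingPairs cs φ α) w,
      Function.Bijective f ∧
        ∀ ω : ReducedWord cs w,
          f ⟨tiling cs φ α ω.1, Set.mem_range_self ω⟩ =
            Quotient.mk (braidSetoid cs (preservingPairs cs φ α) w) ω := by
  -- The class does not depend on which word is chosen for the tiling.
  have hf : ∀ (T : tilingSet cs φ α w) (ω : ReducedWord cs w), tiling cs φ α ω.1 = T.1 →
      Quotient.mk (braidSetoid cs (preservingPairs cs φ α) w) T.2.choose =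
        Quotient.mk (braidSetoid cs (preservingPairs cs φ α) w) ω := fun T ω h =>
    Quotient.sound ((hφ.tiling_eq_iff hα _ _).1 (T.2.choose_spec.trans h.symm))
  refine ⟨fun T => Quotient.mk _ T.2.choose, ⟨fun T T' h => ?_, fun c => ?_⟩,
    fun ω => hf _ ω rfl⟩
  · have h1 : (braidSetoid cs (preservingPairs cs φ α) w).r T.2.choose T'.2.choose :=
      Quotient.exact h
    exact Subtype.ext (T.2.choose_spec.symm.trans
      (((hφ.tiling_eq_iff hα _ _).2 h1).trans T'.2.choose_spec))
  · obtain ⟨ω, rfl⟩ := Quotient.exists_rep c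
    exact ⟨⟨_, Set.mem_range_self ω⟩, hf _ ω rfl⟩
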